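/- Theorem. Let $G(V,E)$ be a finite directed graph with $n=|V|$ nodes and let $f$ be an integer with $n>f>0$. Consider a synchronous system with message authentication whose communication network is $G$ and in which up to $f$ nodes may be Byzantine faulty. Then there is an algorithm that achieves exact binary Byzantine consensus on $G$ if and only if $G$ satisfies Condition S. *Condition S.* A strongly connected component of a directed graph $H$ is a maximal non-empty set of vertices any two of which have directed paths to each other in $H$. A source component of $H$ is a strongly connected component that has no incoming edges from vertices outside it. For $F\subset V$ let $G_F$ be the subgraph of $G$ induced by $V\setminus F$. The graph $G$ satisfies Condition S if for every $F\subset V$ with $|F|\le f$, the graph $G_F$ has a unique source component, and this source component contains at least $f+1$ nodes. *System.* The system operates in synchronous rounds $0,1,2,\dots$. In each round every node $u$ may send a message directly to each node $v$ with $(u,v)\in E$ (and to no other node); it is received in the same round, and the receiver knows on which link it came. Messages are terms built from unsigned data and node identifiers by pairing and by signing; a message signed by $u$ consists of its clear text together with the signature of $u$ on it, so anybody can read it and verify the signature. The algorithm is deterministic and may depend on $G$ and $f$: what a node sends in a round, and whether and what it outputs, are functions of its identity, its binary input $x_u\in\{0,1\}$ and everything it received in the preceding rounds. A non-faulty node follows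 the algorithm, which can make it sign only with its own key. Byzantine faulty nodes may behave arbitrarily and may collude, sharing their keys and everything they have received up to and including the current round, but they cannot forge signatures of non-faulty nodes: every message they send must be producible, by composing, decomposing and signing with the keys of faulty nodes, from unsigned data, node identifiers and the messages that non-faulty nodes have sent to faulty nodes so far. *Exact binary Byzantine consensus.* In every execution with any set of at most $f$ faulty nodes and any inputs: each non-faulty node eventually (and irrevocably) outputs a value (termination); the output at each non-faulty node equals the input of some non-faulty node (validity); and the outputs of the non-faulty nodes are identical (agreement). -/

import Mathlib

/-! ### Directed graphs: source components and the graph condition -/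

namespace Digraph

/-- There is a directed path (possibly of length zero) from `u` to `v` in `H`. -/
def Reachable {U : Type*} (H : Digraph U) (u v : U) : Prop :=
  Relation.ReflTransGen H.Adj u v

/-- A strongly connected component of `H`: a maximal (non-empty) set of vertices such that each
pair of vertices in the set has paths to each other in `H`. -/
def IsStronglyConnectedComponent {U : Type*} (H : Digraph U) (S : Set U) : Prop :=
  S.Nonempty ∧ Maximal (fun T : Set U => ∀ u ∈ T, ∀ v ∈ T, H.Reachable u v) S

/-- A source component of `H`: a strongly connected component without incoming edges from
vertices outside of it. -/
def IsSourceComponent {U : Type*} (H : Digraph U) (S : Set U) : Prop :=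
  H.IsStronglyConnectedComponent S ∧ ∀ u v, u ∉ S → v ∈ S → ¬ H.Adj u v

/-- The graph `G_F`: the subgraph of `G` induced by the vertices outside `F`. -/
def deleteVerts {V : Type*} (G : Digraph V) (F : Finset V) : Digraph {v : V // v ∉ F} where
  Adj u v := G.Adj u v

/-- Condition S with parameter `f`: for every set `F` of at most `f` vertices, the graph `G_F` has
a unique source component, and this component contains at least `f + 1` vertices. -/
def ConditionS {V : Type*} (G : Digraph V) (f : ℕ) : Prop :=
  ∀ F : Finset V, F.card ≤ f →
    ∃ S : Set {v : V // v ∉ F}, (G.deleteVerts F).IsSourceComponent S ∧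
      (∀ T : Set {v : V // v ∉ F}, (G.deleteVerts F).IsSourceComponent T → T = S) ∧
      f + 1 ≤ S.ncard

end Digraph

namespace AuthSync

/-! ### Messages with digital signatures

Signatures are idealized (symbolic) ones. A message is a term built from arbitrary unsigned data
and node identifiers by pairing and signing; `signed u M` is the clear text `M` together with the
signature of node `u` on `M`. Everybody can inspect a message, and in particular read the clear
text of a signed message and verify whose signature it carries. -/

/-- Messages over the set `V` of nodes. -/
inductive Msg (V : Type*) where
  | data (k : ℕ) : Msg V
  | ident (v : V) : Msg V
  | pair (M N : Msg V) : Msg V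
  | signed (u : V) (M : Msg V) : Msg V

/-- `Derivable S K M`: somebody who knows the messages in `K` and holds the signing keys of
exactly the nodes in `S` can produce the message `M`. In particular, for `u ∉ S`, a message signed
by `u` can only be obtained by extracting it, unaltered, from the messages in `K`. -/
inductive Derivable {V : Type*} (S : Set V) (K : Set (Msg V)) : Msg V → Prop where
  | known {M : Msg V} : M ∈ K → Derivable S K M
  | data (k : ℕ) : Derivable S K (Msg.data k)
  | ident (v : V) : Derivable S K (Msg.ident v)
  | pair {M N : Msg V} : Derivable S K M → Derivable S K N → Derivable S K (Msg.pair M N)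
  | fst {M N : Msg V} : Derivable S K (Msg.pair M N) → Derivable S K M
  | snd {M N : Msg V} : Derivable S K (Msg.pair M N) → Derivable S K N
  | sign {u : V} {M : Msg V} : u ∈ S → Derivable S K M → Derivable S K (Msg.signed u M)
  | content {u : V} {M : Msg V} : Derivable S K (Msg.signed u M) → Derivable S K M

/-! ### Synchronous algorithms -/

/-- What a node receives in one round: from each node a message, or nothing. -/
abbrev Inbox (V : Type*) := V → Option (Msg V)

/-- The local history of a node after `t` rounds: the list of its inboxes in rounds
`0, …, t - 1`, in this order. -/
abbrev History (V : Type*) := List (Inbox V)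

/-- The messages that were received in a given local history. -/
def received {V : Type*} (h : History V) : Set (Msg V) :=
  {M | ∃ b ∈ h, ∃ u : V, b u = some M}

/-- A deterministic synchronous algorithm with message authentication. In each round, node `u` with
input `b` and local history `h` sends `send u b h v` to its outgoing neighbor `v` (nothing if this
is `none`), and announces the output `decide u b h` (none yet, if this is `none`).
A node can only sign with its own key: whatever it sends has to be derivable from what it has
received so far with the help of its own signing key. -/
structure Algorithm (V : Type*) where
  send : V → Bool → History V → V → Option (Msg V)
  decide : V → Bool → History V → Option Bool
  send_derivable : ∀ (u : V) (b : Bool) (h : History V) (v : V) (M : Msg V),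
    send u b h v = some M → Derivable {u} (received h) M

/-! ### Executions -/

/-- The messages sent in an execution: `m t u v` is the message which `u` sends to `v`, and which
`v` receives from `u`, in round `t`. -/
abbrev Trace (V : Type*) := ℕ → V → V → Option (Msg V)

/-- The local history of node `v` before round `t`. -/
def history {V : Type*} (m : Trace V) (v : V) (t : ℕ) : History V :=
  (List.range t).map fun s u => m s u v

/-- The messages that the nodes in `F` have obtained from nodes outside `F` in the rounds
up to and including round `t`. -/
def knowledge {V : Type*} (m : Trace V) (F : Finset V) (t : ℕ) : Set (Msg V) :=
  {M | ∃ s ≤ t, ∃ u ∉ F, ∃ v ∈ F, m s u v = some M}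

/-- `m` is the trace of an execution of the algorithm `A` on `G` with inputs `x`, in which the nodes
in `F` are Byzantine faulty. Messages travel along the edges of `G` only, and are delivered in the
round in which they are sent. The nodes outside `F` follow the algorithm. The nodes in `F` behave
arbitrarily and may collude; in particular they can share what they know and their signing keys,
and can see the messages sent to them in the current round before they choose their own.
Their only restriction is that they cannot forge signatures of nodes outside `F`. -/
structure IsExecution {V : Type*} (G : Digraph V) (A : Algorithm V) (x : V → Bool) (F : Finset V)
    (m : Trace V) : Prop where
  along_edges : ∀ t u v, ¬ G.Adj u v → m t u v = none
  correct : ∀ t, ∀ u ∉ F, ∀ v, G.Adj u v → m t u v = A.send u (x u) (history m u t) v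
  faulty : ∀ t, ∀ u ∈ F, ∀ v M, m t u v = some M →
    Derivable (F : Set V) (knowledge m F t) M

/-- Node `v`, running the algorithm `A` with input `x v`, outputs `y`: this is the first (and hence
irrevocable) output that it announces. -/
def Outputs {V : Type*} (A : Algorithm V) (x : V → Bool) (m : Trace V) (v : V) (y : Bool) : Prop :=
  ∃ t, A.decide v (x v) (history m v t) = some y ∧
    ∀ s < t, A.decide v (x v) (history m v s) = none

/-- The algorithm `A` achieves exact binary Byzantine consensus on `G` in the presence of up to `f`
Byzantine faulty nodes: every execution satisfies termination, validity and agreement. -/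
structure SolvesConsensus {V : Type*} (G : Digraph V) (f : ℕ) (A : Algorithm V) : Prop where
  termination : ∀ (F : Finset V), F.card ≤ f → ∀ (x : V → Bool) (m : Trace V),
    IsExecution G A x F m → ∀ v ∉ F, ∃ y, Outputs A x m v y
  validity : ∀ (F : Finset V), F.card ≤ f → ∀ (x : V → Bool) (m : Trace V),
    IsExecution G A x F m → ∀ v ∉ F, ∀ y, Outputs A x m v y → ∃ u ∉ F, y = x u
  agreement : ∀ (F : Finset V), F.card ≤ f → ∀ (x : V → Bool) (m : Trace V),
    IsExecution G A x F m → ∀ u ∉ F, ∀ v ∉ F, ∀ y z, Outputs A x m u y → Outputs A x m v z → y = z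

end AuthSync

/-! Consensus is possible on `G` exactly when Condition S holds, and both directions turn on what the
source components of the graphs `G_F` can learn.

*Necessity.* A set `S` that is a source component of `G_F` hears only from itself and from `F`. If
the nodes of `F` are faulty and silent towards `S`, then `S` cannot see any input outside of `S`, so
when all inputs in `S` are `c`, validity forces the output `c`
(`SolvesConsensus.outputs_of_closed`). Two source components with different inputs would therefore
violate agreement (`SolvesConsensus.not_disjoint_of_closed`). If a source component `S` has at most
`f` nodes, give it input `0` and all other nodes input `1`, and drop all messages from `F` to `S`.
With `F` faulty, `S` outputs `0`. The nodes outside of `S ∪ F` see the same as when `S` is faulty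
and merely pretends not to hear `F`, so they output `1`; if there are none, the fault-free execution
is compared with the ones in which `S` or `F` is nominally faulty but behaves correctly
(`SolvesConsensus.lt_card_of_closed`).

*Sufficiency.* Condition S supplies for every `F` with `|F| ≤ f` a root set: at least `f + 1` nodes,
each of which reaches every node outside of `F` by a non-trivial path avoiding `F`. In every round
every node sends the signed triple of the round number, its current value and everything received so
far. A signed triple of a non-faulty node that occurs anywhere in any message is genuine
(`genuine_of_mem_parts`), and it reaches everybody reachable in `G_F` within a fixed number `L` of
rounds (`exists_delay`).

The computation runs in phases of `2 * L` rounds, one for each candidate faulty set, with root set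
`S`. At the end of a phase, a node that holds signed views of all members of `S` from the middle of
the phase counts the nodes for which these views contain a signed claim of value `0` at the start
of the phase. It takes the value `0` if there are at least `f + 1` such nodes, and `1` otherwise; a
node that lacks one of the views keeps its value. The new value was always held by a non-faulty node
at the start of the phase (`exists_value_eq`): among `f + 1` claims of `0` one is genuine, while
otherwise some member of the root set for the actual faulty set does not claim `0`, although its
claim occurs in the view of a non-faulty member of `S`. In the phase of the actual faulty set, all
members of `S` are non-faulty, hence everybody uses the same views and computes the same value
(`value_eq_of_rootSet`), and later phases preserve agreement. -/

/-! ### Source components of finite digraphs -/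

namespace Digraph

/-- The source component is the strongly connected component of an ancestor of `v` that has the
fewest ancestors itself. -/
theorem exists_isSourceComponent_reachable {U : Type*} [Finite U] (H : Digraph U) (v : U) :
    ∃ S, H.IsSourceComponent S ∧ ∀ p ∈ S, H.Reachable p v := by
  obtain ⟨w, hwv, hmin⟩ := Set.exists_min_image {w | H.Reachable w v}
    (fun w => {z | H.Reachable z w}.ncard) (Set.toFinite _) ⟨v, Relation.ReflTransGen.refl⟩
  refine ⟨{z | H.Reachable z w ∧ H.Reachable w z}, ⟨⟨⟨w, .refl, .refl⟩, ?_, ?_⟩, ?_⟩, ?_⟩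
  · intro a ha b hb
    exact ha.1.trans hb.2
  · intro T hT hle z hz
    have hw : w ∈ T := hle ⟨.refl, .refl⟩
    exact ⟨hT z hz w hw, hT w hw z hz⟩
  · intro a b ha hb hab
    have haw : H.Reachable a w := Relation.ReflTransGen.head hab hb.1
    have hsub : {z | H.Reachable z a} ⊆ {z | H.Reachable z w} := fun z hz => hz.trans haw
    have heq := Set.eq_of_subset_of_ncard_le hsub (hmin a (haw.trans hwv)) (Set.toFinite _)
    have hwa : w ∈ {z | H.Reachable z a} := heq ▸ (Relation.ReflTransGen.refl : H.Reachable w w)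
    exact ha ⟨haw, hwa⟩
  · intro p hp
    exact hp.1.trans hwv

theorem IsStronglyConnectedComponent.eq_of_mem {U : Type*} {H : Digraph U} {S T : Set U}
    (hS : H.IsStronglyConnectedComponent S) (hT : H.IsStronglyConnectedComponent T) {a : U}
    (haS : a ∈ S) (haT : a ∈ T) : S = T := by
  have h : ∀ u ∈ S ∪ T, ∀ v ∈ S ∪ T, H.Reachable u v := by
    have h1 : ∀ u ∈ S ∪ T, H.Reachable u a ∧ H.Reachable a u := by
      rintro u (hu | hu)
      · exact ⟨hS.2.prop u hu a haS, hS.2.prop a haS u hu⟩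
      · exact ⟨hT.2.prop u hu a haT, hT.2.prop a haT u hu⟩
    exact fun u hu v hv => (h1 u hu).1.trans (h1 v hv).2
  rw [hS.2.eq_of_subset h Set.subset_union_left]
  exact (hT.2.eq_of_subset h Set.subset_union_right).symm

/-- The edges of `G` between vertices outside of `F`, as a relation on all vertices. -/
def AdjOff {V : Type*} (G : Digraph V) (F : Finset V) (u v : V) : Prop :=
  G.Adj u v ∧ u ∉ F ∧ v ∉ F

/-- `S` is disjoint from `F`, and each vertex of `S` reaches every vertex outside of `F`, itself
included, by a path of positive length avoiding `F`. Positive length makes sure that a node also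
receives its own messages back. -/
def IsRootSet {V : Type*} (G : Digraph V) (F S : Finset V) : Prop :=
  ∀ p ∈ S, p ∉ F ∧ ∀ v ∉ F, Relation.TransGen (G.AdjOff F) p v

theorem ConditionS.exists_isRootSet {V : Type*} [Finite V] {G : Digraph V} {f : ℕ}
    (h : G.ConditionS f) (hf : 0 < f) (F : Finset V) (hF : F.card ≤ f) :
    ∃ S : Finset V, f + 1 ≤ S.card ∧ G.IsRootSet F S := by
  obtain ⟨S, hS, huniq, hcard⟩ := h F hF
  have hreach : ∀ p ∈ S, ∀ v, (G.deleteVerts F).Reachable p v := by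
    intro p hp v
    obtain ⟨T, hT, hTv⟩ := exists_isSourceComponent_reachable (G.deleteVerts F) v
    exact hTv p (huniq T hT ▸ hp)
  have hlift : ∀ a b : {v : V // v ∉ F}, (G.deleteVerts F).Reachable a b →
      Relation.ReflTransGen (G.AdjOff F) a b := by
    intro a b hab
    induction hab with
    | refl => exact .refl
    | @tail b c _ h ih => exact ih.tail ⟨h, b.2, c.2⟩
  have hne : ∀ a b : {v : V // v ∉ F}, a ≠ b → (G.deleteVerts F).Reachable a b →
      Relation.TransGen (G.AdjOff F) a b := by
    intro a b hab h
    rcases Relation.reflTransGen_iff_eq_or_transGen.1 (hlift a b h) with h | h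
    · exact absurd (Subtype.ext h.symm) hab
    · exact h
  have hfin : (Subtype.val '' S).Finite := Set.toFinite _
  refine ⟨hfin.toFinset, ?_, ?_⟩
  · rw [← Set.ncard_eq_toFinset_card _ hfin, Set.ncard_image_of_injective _ Subtype.val_injective]
    exact hcard
  · intro p hp
    rw [Set.Finite.mem_toFinset] at hp
    obtain ⟨p, hp, rfl⟩ := hp
    refine ⟨p.2, fun v hv => ?_⟩
    by_cases hpv : p = ⟨v, hv⟩
    · -- A closed path from `p` to itself goes through another vertex of the component.
      obtain ⟨q, hq, hqp⟩ := Set.exists_ne_of_one_lt_ncard (by omega : 1 < S.ncard) p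
      have h1 := hne p q hqp.symm (hreach p hp q)
      have h2 := hne q p hqp (hreach q hq p)
      have := h1.trans h2
      rwa [hpv] at this ⊢
    · exact hne p ⟨v, hv⟩ hpv (hreach p hp _)

end Digraph

namespace AuthSync

variable {V : Type*}

/-! ### Histories and derivability -/

theorem Derivable.cut {S S' : Set V} {K K' : Set (Msg V)} {M : Msg V} (h : Derivable S K M)
    (hS : S ⊆ S') (hK : ∀ N ∈ K, Derivable S' K' N) : Derivable S' K' M := by
  induction h with
  | known h => exact hK _ h
  | data k => exact .data k
  | ident v => exact .ident v
  | pair _ _ ih1 ih2 => exact .pair ih1 ih2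
  | fst _ ih => exact .fst ih
  | snd _ ih => exact .snd ih
  | sign hu _ ih => exact .sign (hS hu) ih
  | content _ ih => exact .content ih

theorem history_succ (m : Trace V) (v : V) (t : ℕ) :
    history m v (t + 1) = history m v t ++ [fun u => m t u v] := by
  simp [history, List.range_succ]

@[simp]
theorem length_history (m : Trace V) (v : V) (t : ℕ) : (history m v t).length = t := by
  simp [history]

theorem take_history (m : Trace V) (v : V) {s t : ℕ} (h : s ≤ t) :
    (history m v t).take s = history m v s := by
  simp [history, ← List.map_take, List.take_range, h]

theorem mem_received_history {m : Trace V} {v : V} {t : ℕ} {M : Msg V} :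
    M ∈ received (history m v t) ↔ ∃ s < t, ∃ u, m s u v = some M := by
  simp [received, history]

theorem history_congr {m m' : Trace V} {v : V} (h : ∀ t u, m t u v = m' t u v) (t : ℕ) :
    history m v t = history m' v t := by
  simp [history, h]

theorem Outputs.congr {A : Algorithm V} {x x' : V → Bool} {m m' : Trace V} {v : V} {y : Bool}
    (h : Outputs A x m v y) (hx : x v = x' v) (hm : ∀ t, history m v t = history m' v t) :
    Outputs A x' m' v y := by
  simpa only [Outputs, hx, hm] using h

/-- Faulty nodes that use only their own key and what they received respect the restriction on
faulty nodes. What they received from other faulty nodes was derivable by induction. -/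
theorem derivable_knowledge {m : Trace V} {F : Finset V}
    (h : ∀ t, ∀ u ∈ F, ∀ v M, m t u v = some M → Derivable {u} (received (history m u t)) M) :
    ∀ t, ∀ u ∈ F, ∀ v M, m t u v = some M → Derivable (F : Set V) (knowledge m F t) M := by
  intro t
  induction t using Nat.strong_induction_on with
  | _ t ih =>
    intro u hu v M hM
    refine (h t u hu v M hM).cut (by simpa using hu) fun N hN => ?_
    obtain ⟨s, hs, w, hw⟩ := mem_received_history.1 hN
    by_cases hwF : w ∈ F
    · refine (ih s hs w hwF u N hw).cut subset_rfl fun N' hN' => ?_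
      obtain ⟨r, hr, z⟩ := hN'
      exact .known ⟨r, hr.trans hs.le, z⟩
    · exact .known ⟨s, hs.le, w, hwF, u, hu, hw⟩

/-! ### Executions without misbehaviour on a subgraph -/

open Classical in
/-- The local histories when all nodes follow `A` and messages travel along the edges of `H`. -/
noncomputable def honestHistory (H : Digraph V) (A : Algorithm V) (x : V → Bool) :
    ℕ → V → History V
  | 0 => fun _ => []
  | t + 1 => fun v => honestHistory H A x t v ++
      [fun u => if H.Adj u v then A.send u (x u) (honestHistory H A x t u) v else none]

open Classical in
/-- The trace in which all nodes follow `A` and messages travel along the edges of `H`. -/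
noncomputable def honestTrace (H : Digraph V) (A : Algorithm V) (x : V → Bool) : Trace V :=
  fun t u v => if H.Adj u v then A.send u (x u) (honestHistory H A x t u) v else none

theorem history_honestTrace (H : Digraph V) (A : Algorithm V) (x : V → Bool) (v : V) (t : ℕ) :
    history (honestTrace H A x) v t = honestHistory H A x t v := by
  induction t with
  | zero => rfl
  | succ t ih => rw [history_succ, ih]; rfl

theorem honestTrace_of_adj {H : Digraph V} {A : Algorithm V} {x : V → Bool} {t : ℕ} {u v : V}
    (h : H.Adj u v) : honestTrace H A x t u v =
      A.send u (x u) (history (honestTrace H A x) u t) v := by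
  rw [history_honestTrace, honestTrace, if_pos h]

theorem honestTrace_of_not_adj {H : Digraph V} {A : Algorithm V} {x : V → Bool} {t : ℕ} {u v : V}
    (h : ¬ H.Adj u v) : honestTrace H A x t u v = none := by
  rw [honestTrace, if_neg h]

theorem derivable_of_honestTrace {H : Digraph V} {A : Algorithm V} {x : V → Bool} {t : ℕ}
    {u v : V} {M : Msg V} (h : honestTrace H A x t u v = some M) :
    Derivable {u} (received (history (honestTrace H A x) u t)) M := by
  by_cases hadj : H.Adj u v
  · rw [honestTrace_of_adj hadj] at h
    exact A.send_derivable _ _ _ _ _ h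
  · simp [honestTrace_of_not_adj hadj] at h

/-- Faulty nodes may omit messages: deleting edges that start in `F` is a possible misbehaviour
of `F`. -/
theorem isExecution_honestTrace {G H : Digraph V} {A : Algorithm V} {x : V → Bool} {F : Finset V}
    (hHG : ∀ u v, H.Adj u v → G.Adj u v) (hGH : ∀ u v, u ∉ F → G.Adj u v → H.Adj u v) :
    IsExecution G A x F (honestTrace H A x) where
  along_edges _ u v h := honestTrace_of_not_adj fun h' => h (hHG u v h')
  correct _ u hu v h := honestTrace_of_adj (hGH u v hu h)
  faulty := derivable_knowledge fun _ _ _ _ _ hM => derivable_of_honestTrace hM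

/-- A set without incoming edges in `H` sees only the inputs of its own members. -/
theorem history_honestTrace_congr {H : Digraph V} {A : Algorithm V} {x x' : V → Bool} {S : Set V}
    (hS : ∀ u, ∀ v ∈ S, H.Adj u v → u ∈ S) (hx : ∀ v ∈ S, x v = x' v) (t : ℕ) :
    ∀ v ∈ S, history (honestTrace H A x) v t = history (honestTrace H A x') v t := by
  induction t with
  | zero => intro v _; rfl
  | succ t ih =>
    intro v hv
    rw [history_succ, history_succ, ih v hv]
    congr 2
    funext u
    by_cases h : H.Adj u v
    · have hu := hS u v hv h
      rw [honestTrace_of_adj h, honestTrace_of_adj h, ih u hu, hx u hu]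
    · rw [honestTrace_of_not_adj h, honestTrace_of_not_adj h]

/-! ### Necessity of Condition S -/

namespace SolvesConsensus

variable {G : Digraph V} {f : ℕ} {A : Algorithm V}

theorem outputs_of_forall_eq (hA : SolvesConsensus G f A) {F : Finset V} (hF : F.card ≤ f)
    {x : V → Bool} {m : Trace V} (hm : IsExecution G A x F m) {c : Bool} (hx : ∀ u ∉ F, x u = c)
    {v : V} (hv : v ∉ F) : Outputs A x m v c := by
  obtain ⟨y, hy⟩ := hA.termination F hF x m hm v hv
  obtain ⟨u, hu, rfl⟩ := hA.validity F hF x m hm v hv y hy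
  exact hx u hu ▸ hy

/-- A set that hears only from itself outputs the common input of its members: it cannot exclude
that all inputs are the same. -/
theorem outputs_of_closed (hA : SolvesConsensus G f A) {F : Finset V} (hF : F.card ≤ f)
    {H : Digraph V} (hHG : ∀ u v, H.Adj u v → G.Adj u v)
    (hGH : ∀ u v, u ∉ F → G.Adj u v → H.Adj u v) {S : Set V}
    (hS : ∀ u, ∀ v ∈ S, H.Adj u v → u ∈ S) {x : V → Bool} {c : Bool} (hx : ∀ v ∈ S, x v = c)
    {v : V} (hv : v ∈ S) (hvF : v ∉ F) : Outputs A x (honestTrace H A x) v c := by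
  have h := hA.outputs_of_forall_eq (x := fun _ => c) (c := c) hF
    (isExecution_honestTrace hHG hGH) (fun _ _ => rfl) hvF
  exact h.congr (hx v hv).symm fun t =>
    (history_honestTrace_congr hS hx t v hv).symm

/-- Disjoint sets that hear only from themselves and from a silent `F` are free to disagree. -/
theorem not_disjoint_of_closed (hA : SolvesConsensus G f A) {F : Finset V} (hF : F.card ≤ f)
    {S T : Set V} (hS : ∀ u ∉ F, ∀ v ∈ S, G.Adj u v → u ∈ S)
    (hT : ∀ u ∉ F, ∀ v ∈ T, G.Adj u v → u ∈ T) {a b : V} (ha : a ∈ S) (haF : a ∉ F)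
    (hb : b ∈ T) (hbF : b ∉ F) : ¬ Disjoint S T := by
  classical
  intro hdis
  -- The nodes of `F` are silent.
  let H : Digraph V := ⟨fun u v => G.Adj u v ∧ u ∉ F⟩
  let x : V → Bool := fun v => decide (v ∉ S)
  have hHG : ∀ u v, H.Adj u v → G.Adj u v := fun u v h => h.1
  have hGH : ∀ u v, u ∉ F → G.Adj u v → H.Adj u v := fun u v hu h => ⟨h, hu⟩
  have h0 : Outputs A x (honestTrace H A x) a false :=
    hA.outputs_of_closed hF hHG hGH (fun u v hv h => hS u h.2 v hv h.1)
      (fun v hv => by simpa [x] using hv) ha haF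
  have h1 : Outputs A x (honestTrace H A x) b true :=
    hA.outputs_of_closed hF hHG hGH (fun u v hv h => hT u h.2 v hv h.1)
      (fun v hv => by simpa [x] using fun h => hdis.notMem_of_mem_left h hv) hb hbF
  have := hA.agreement F hF x _ (isExecution_honestTrace hHG hGH) a haF b hbF _ _ h0 h1
  simp at this

/-- If `S` had at most `f` members, then nodes outside of it could not tell whether `S` ignores a
silent `F` or is faulty and only pretends to. -/
theorem lt_card_of_closed [Fintype V] (hA : SolvesConsensus G f A) (hn : f < Fintype.card V)
    {F : Finset V} (hF : F.card ≤ f) {S : Finset V} (hS : ∀ u ∉ F, ∀ v ∈ S, G.Adj u v → u ∈ S)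
    (hne : S.Nonempty) (hdis : ∀ v ∈ S, v ∉ F) : f < S.card := by
  classical
  by_contra! hcard
  obtain ⟨a, ha⟩ := hne
  let x : V → Bool := fun v => decide (v ∉ S)
  have hx0 : ∀ v ∈ S, x v = false := fun v hv => by simpa [x] using hv
  have hx1 : ∀ v ∉ S, x v = true := fun v hv => by simpa [x] using hv
  by_cases hT : ∃ b, b ∉ S ∧ b ∉ F
  · obtain ⟨b, hbS, hbF⟩ := hT
    let H : Digraph V := ⟨fun u v => G.Adj u v ∧ ¬ (u ∈ F ∧ v ∈ S)⟩
    have hHG : ∀ u v, H.Adj u v → G.Adj u v := fun u v h => h.1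
    have hGH : ∀ u v, u ∉ F → G.Adj u v → H.Adj u v := fun u v hu h => ⟨h, fun h' => hu h'.1⟩
    let m := honestTrace H A x
    have h0 : Outputs A x m a false :=
      hA.outputs_of_closed (S := S) hF hHG hGH
        (fun u v hv h => hS u (fun hu => h.2 ⟨hu, hv⟩) v hv h.1) hx0 ha (hdis a ha)
    -- Now `S` is faulty and acts as if it did not receive the messages from `F`.
    let m' : Trace V := fun t u v =>
      if G.Adj u v ∧ u ∈ F ∧ v ∈ S then A.send u (x u) (history m u t) v else m t u v
    have hmm' : ∀ t u v, v ∉ S → m' t u v = m t u v := fun t u v hv => by simp [m', hv]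
    have hhist : ∀ v ∉ S, ∀ t, history m' v t = history m v t := fun v hv t =>
      history_congr (fun t u => hmm' t u v hv) t
    have hexec : IsExecution G A x S m' := by
      refine ⟨?_, ?_, derivable_knowledge ?_⟩
      · intro t u v h
        rw [show m' t u v = m t u v by simp [m', h]]
        exact honestTrace_of_not_adj fun h' => h h'.1
      · intro t u hu v h
        rw [hhist u hu]
        by_cases h' : u ∈ F ∧ v ∈ S
        · simp [m', h, h']
        · rw [show m' t u v = m t u v by simp only [m', h', and_false, if_false]]
          exact honestTrace_of_adj ⟨h, h'⟩
      · intro t u hu v M hM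
        rw [show m' t u v = m t u v by simp [m', hdis u hu]] at hM
        refine (derivable_of_honestTrace hM).cut subset_rfl fun N hN => .known ?_
        obtain ⟨s, hs, w, hw⟩ := mem_received_history.1 hN
        refine mem_received_history.2 ⟨s, hs, w, ?_⟩
        have hadj : H.Adj w u := by
          by_contra h
          rw [honestTrace_of_not_adj h] at hw
          exact absurd hw (by simp)
        rw [← hw]
        exact if_neg fun h => hadj.2 h.2
    have h1 : Outputs A x m b true :=
      (hA.outputs_of_forall_eq hcard hexec hx1 hbS).congr rfl (hhist b hbS)
    have := hA.agreement F hF x m (isExecution_honestTrace hHG hGH) a (hdis a ha) b hbF _ _ h0 h1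
    simp at this
  · push Not at hT
    have hexec : ∀ F' : Finset V, IsExecution G A x F' (honestTrace G A x) := fun F' =>
      isExecution_honestTrace (fun _ _ h => h) fun _ _ _ h => h
    obtain ⟨b, hb⟩ : ∃ b, b ∉ S := by
      by_contra! h
      rw [Finset.eq_univ_iff_forall.2 h, Finset.card_univ] at hcard
      omega
    have h0 : Outputs A x (honestTrace G A x) a false :=
      hA.outputs_of_forall_eq hF (hexec F) (fun u hu => hx0 u (by_contra fun h => hu (hT u h)))
        (hdis a ha)
    have h1 : Outputs A x (honestTrace G A x) b true :=
      hA.outputs_of_forall_eq hcard (hexec S) hx1 hb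
    have := hA.agreement ∅ (by simp) x _ (hexec ∅) a (by simp) b (by simp) _ _ h0 h1
    simp at this

theorem conditionS [Fintype V] (hA : SolvesConsensus G f A) (hn : f < Fintype.card V) :
    G.ConditionS f := by
  classical
  intro F hF
  have hclosed : ∀ S, (G.deleteVerts F).IsSourceComponent S → ∀ u ∉ F,
      ∀ v ∈ Subtype.val '' S, G.Adj u v → u ∈ Subtype.val '' S := by
    rintro S hS u hu _ ⟨v, hv, rfl⟩ hadj
    by_contra h
    exact hS.2 ⟨u, hu⟩ v (fun h' => h ⟨_, h', rfl⟩) hv hadj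
  obtain ⟨w, hw⟩ : ∃ w, w ∉ F := by
    by_contra! h
    rw [Finset.eq_univ_iff_forall.2 h, Finset.card_univ] at hF
    omega
  obtain ⟨S, hS, -⟩ := (G.deleteVerts F).exists_isSourceComponent_reachable ⟨w, hw⟩
  refine ⟨S, hS, fun T hT => ?_, ?_⟩
  · obtain ⟨a, ha⟩ := hS.1.1
    obtain ⟨b, hb⟩ := hT.1.1
    have h := hA.not_disjoint_of_closed hF (hclosed S hS) (hclosed T hT) ⟨a, ha, rfl⟩ a.2
      ⟨b, hb, rfl⟩ b.2
    obtain ⟨_, ⟨c, hcS, rfl⟩, ⟨d, hdT, hcd⟩⟩ := Set.not_disjoint_iff.1 h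
    exact hT.1.eq_of_mem hS.1 hdT (Subtype.ext hcd ▸ hcS)
  · have hfin : (Subtype.val '' S).Finite := Set.toFinite _
    have h := hA.lt_card_of_closed (S := hfin.toFinset) hn hF
      (by simpa only [Set.Finite.mem_toFinset] using hclosed S hS)
      (by simpa using hS.1.1)
      (by
        intro v hv
        obtain ⟨v, -, rfl⟩ := hfin.mem_toFinset.1 hv
        exact v.2)
    rwa [← Set.ncard_eq_toFinset_card _ hfin,
      Set.ncard_image_of_injective _ Subtype.val_injective] at h

end SolvesConsensus

/-! ### Subterms of messages -/

/-- The subterms of a message, including those below signatures. -/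
def Msg.parts : Msg V → Set (Msg V)
  | .data k => {.data k}
  | .ident v => {.ident v}
  | .pair M N => insert (.pair M N) (M.parts ∪ N.parts)
  | .signed u M => insert (.signed u M) M.parts

theorem Msg.self_mem_parts (M : Msg V) : M ∈ M.parts := by
  cases M <;> simp [Msg.parts]

theorem Msg.parts_trans {L M N : Msg V} (h1 : L ∈ M.parts) (h2 : M ∈ N.parts) : L ∈ N.parts := by
  induction N with
  | data k => simp only [parts, Set.mem_singleton_iff] at h2; exact h2 ▸ h1
  | ident v => simp only [parts, Set.mem_singleton_iff] at h2; exact h2 ▸ h1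
  | pair N N' ih ih' =>
    rcases h2 with rfl | h2 | h2
    · exact h1
    · exact .inr (.inl (ih h2))
    · exact .inr (.inr (ih' h2))
  | signed u N ih =>
    rcases h2 with rfl | h2
    · exact h1
    · exact .inr (ih h2)

/-- Without the key of `q`, messages signed by `q` can only be taken from known messages. -/
theorem Derivable.exists_mem_parts {S : Set V} {K : Set (Msg V)} {M N : Msg V} {q : V}
    (h : Derivable S K M) (hq : q ∉ S) (hN : Msg.signed q N ∈ M.parts) :
    ∃ M' ∈ K, Msg.signed q N ∈ M'.parts := by
  induction h with
  | known h => exact ⟨_, h, hN⟩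
  | data k => simp [Msg.parts] at hN
  | ident v => simp [Msg.parts] at hN
  | pair _ _ ih1 ih2 =>
    rcases hN with hN | hN | hN
    · cases hN
    · exact ih1 hN
    · exact ih2 hN
  | fst _ ih => exact ih (.inr (.inl hN))
  | snd _ ih => exact ih (.inr (.inr hN))
  | sign hu _ ih =>
    rcases hN with hN | hN
    · cases hN
      exact absurd hu hq
    · exact ih hN
  | content _ ih => exact ih (.inr hN)

/-- A single message that contains the messages of a list. -/
def bundleList : List (Msg V) → Msg V
  | [] => .data 0
  | M :: l => .pair M (bundleList l)

theorem signed_mem_parts_bundleList {l : List (Msg V)} {q : V} {N : Msg V} :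
    Msg.signed q N ∈ (bundleList l).parts ↔ ∃ M ∈ l, Msg.signed q N ∈ M.parts := by
  induction l with
  | nil => simp [bundleList, Msg.parts]
  | cons M l ih => simp [bundleList, Msg.parts, ih]

theorem derivable_bundleList {S : Set V} {K : Set (Msg V)} {l : List (Msg V)}
    (h : ∀ M ∈ l, M ∈ K) : Derivable S K (bundleList l) := by
  induction l with
  | nil => exact .data 0
  | cons M l ih =>
    exact .pair (.known (h M (by simp))) (ih fun N hN => h N (by simp [hN]))

/-- A single message that contains all messages received in a local history. -/
noncomputable def bundle [Fintype V] (h : History V) : Msg V :=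
  bundleList (h.flatMap fun b => (Finset.univ : Finset V).toList.filterMap b)

/-- The message `N` occurs in a message received in the local history `h`. -/
def Knows (h : History V) (N : Msg V) : Prop :=
  ∃ M ∈ received h, N ∈ M.parts

theorem Knows.mono {v : V} {N : Msg V} {s t : ℕ} (h : Knows (history m v s) N) (hst : s ≤ t) :
    Knows (history m v t) N := by
  obtain ⟨M, hM, hN⟩ := h
  obtain ⟨r, hr, u, hu⟩ := mem_received_history.1 hM
  exact ⟨M, mem_received_history.2 ⟨r, by omega, u, hu⟩, hN⟩

theorem mem_bundle_iff [Fintype V] {h : History V} {M : Msg V} :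
    M ∈ h.flatMap (fun b => (Finset.univ : Finset V).toList.filterMap b) ↔ M ∈ received h := by
  simp [received]

theorem signed_mem_parts_bundle [Fintype V] {h : History V} {q : V} {N : Msg V} :
    Msg.signed q N ∈ (bundle h).parts ↔ Knows h (.signed q N) := by
  simp only [bundle, signed_mem_parts_bundleList, mem_bundle_iff, Knows]

theorem derivable_bundle [Fintype V] (S : Set V) (h : History V) :
    Derivable S (received h) (bundle h) :=
  derivable_bundleList fun _ => mem_bundle_iff.1

/-! ### Full-information algorithms -/

/-- The content of a message: a time, a value, and further information. -/
def report (t : ℕ) (c : Bool) (B : Msg V) : Msg V :=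
  .pair (.data t) (.pair (.data c.toNat) B)

theorem report_inj {t t' : ℕ} {c c' : Bool} {B B' : Msg V} :
    report t c B = report t' c' B' ↔ t = t' ∧ c = c' ∧ B = B' := by
  cases c <;> cases c' <;> simp [report]

theorem signed_mem_parts_report {t : ℕ} {c : Bool} {B N : Msg V} {q : V} :
    Msg.signed q N ∈ (report t c B).parts ↔ Msg.signed q N ∈ B.parts := by
  simp [report, Msg.parts]

/-- Whatever a known report contains is known. -/
theorem Knows.of_report {h : History V} {t : ℕ} {c : Bool} {B N : Msg V} {p q : V}
    (hB : Knows h (.signed p (report t c B))) (hN : Msg.signed q N ∈ B.parts) :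
    Knows h (.signed q N) := by
  obtain ⟨M, hM, hM'⟩ := hB
  exact ⟨M, hM, Msg.parts_trans (Set.mem_insert_of_mem _ (signed_mem_parts_report.2 hN)) hM'⟩

/-- The algorithm in which every node sends in every round the signed report of the time, its
current value `val b h`, and everything that it has received. -/
noncomputable def fullInformation [Fintype V] (val : Bool → History V → Bool)
    (dec : Bool → History V → Option Bool) : Algorithm V where
  send u b h _ := some (.signed u (report h.length (val b h) (bundle h)))
  decide _ b h := dec b h
  send_derivable := by
    rintro u b h v M hM
    cases hM
    exact .sign rfl (.pair (.data _) (.pair (.data _) (derivable_bundle _ h)))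

section FullInformation

variable [Fintype V] {G : Digraph V} {val : Bool → History V → Bool}
  {dec : Bool → History V → Option Bool} {x : V → Bool} {F : Finset V} {m : Trace V}

/-- The content which the non-faulty node `u` signs in round `t`. -/
noncomputable def ownReport (val : Bool → History V → Bool) (x : V → Bool) (m : Trace V) (u : V)
    (t : ℕ) : Msg V :=
  report t (val (x u) (history m u t)) (bundle (history m u t))

theorem trace_eq_of_adj (hm : IsExecution G (fullInformation val dec) x F m) {u v : V}
    (hu : u ∉ F) (h : G.Adj u v) (t : ℕ) :
    m t u v = some (.signed u (ownReport val x m u t)) := by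
  rw [hm.correct t u hu v h]
  simp [fullInformation, ownReport]

/-- Unforgeability: whatever occurs in a message with the signature of a non-faulty node has been
signed by that node as its report of some round. -/
theorem genuine_of_mem_parts (hm : IsExecution G (fullInformation val dec) x F m) {q : V}
    (hq : q ∉ F) {N : Msg V} (t : ℕ) : ∀ u v M, m t u v = some M →
      Msg.signed q N ∈ M.parts → ∃ s, N = ownReport val x m q s := by
  induction t using Nat.strong_induction_on with
  | _ t ih =>
    have hcorrect : ∀ s ≤ t, ∀ u ∉ F, ∀ v M, m s u v = some M →
        Msg.signed q N ∈ M.parts → ∃ s, N = ownReport val x m q s := by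
      intro s hs u hu v M hM hN
      have hadj : G.Adj u v := by
        by_contra h
        rw [hm.along_edges s u v h] at hM
        cases hM
      rw [trace_eq_of_adj hm hu hadj] at hM
      cases hM
      rcases hN with hN | hN
      · cases hN
        exact ⟨s, rfl⟩
      · rw [ownReport, signed_mem_parts_report, signed_mem_parts_bundle] at hN
        obtain ⟨M, hM, hN⟩ := hN
        obtain ⟨r, hr, w, hw⟩ := mem_received_history.1 hM
        exact ih r (by omega) w u M hw hN
    intro u v M hM hN
    by_cases hu : u ∈ F
    · obtain ⟨M', ⟨s, hs, w, hw, z, -, hM'⟩, hN'⟩ :=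
        (hm.faulty t u hu v M hM).exists_mem_parts (by simpa using hq) hN
      exact hcorrect s hs w hw z M' hM' hN'
    · exact hcorrect t le_rfl u hu v M hM hN

theorem Knows.genuine (hm : IsExecution G (fullInformation val dec) x F m) {q v : V} (hq : q ∉ F)
    {N : Msg V} {t : ℕ} (h : Knows (history m v t) (.signed q N)) :
    ∃ s, N = ownReport val x m q s := by
  obtain ⟨M, hM, hN⟩ := h
  obtain ⟨s, -, u, hu⟩ := mem_received_history.1 hM
  exact genuine_of_mem_parts hm hq s u v M hu hN

theorem knows_of_adj (hm : IsExecution G (fullInformation val dec) x F m) {u v : V} (hu : u ∉ F)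
    (h : G.Adj u v) (t : ℕ) :
    Knows (history m v (t + 1)) (.signed u (ownReport val x m u t)) :=
  ⟨_, mem_received_history.2 ⟨t, by omega, u, trace_eq_of_adj hm hu h t⟩, Msg.self_mem_parts _⟩

theorem Knows.relay (hm : IsExecution G (fullInformation val dec) x F m) {u v : V} (hu : u ∉ F)
    (h : G.Adj u v) {t : ℕ} {q : V} {N : Msg V} (hN : Knows (history m u t) (.signed q N)) :
    Knows (history m v (t + 1)) (.signed q N) :=
  (knows_of_adj hm hu h t).of_report (signed_mem_parts_bundle.2 hN)

/-- The bound on the delay depends neither on the execution nor on how the nodes compute their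
values, so that the algorithm can be built with the bound in hand. -/
theorem exists_delay (G : Digraph V) : ∃ L : ℕ, 0 < L ∧
    ∀ (val : Bool → History V → Bool) (dec : Bool → History V → Option Bool) (x : V → Bool)
      (F : Finset V) (m : Trace V), IsExecution G (fullInformation val dec) x F m →
      ∀ p v, Relation.TransGen (G.AdjOff F) p v → ∀ t,
        Knows (history m v (t + L)) (.signed p (ownReport val x m p t)) := by
  have h : ∀ a : Finset V × V × V, ∃ d : ℕ, Relation.TransGen (G.AdjOff a.1) a.2.1 a.2.2 →
      ∀ (val : Bool → History V → Bool) (dec : Bool → History V → Option Bool) (x : V → Bool)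
        (m : Trace V), IsExecution G (fullInformation val dec) x a.1 m → ∀ t,
        Knows (history m a.2.2 (t + d)) (.signed a.2.1 (ownReport val x m a.2.1 t)) := by
    rintro ⟨F, p, v⟩
    by_cases hpv : Relation.TransGen (G.AdjOff F) p v
    · simp only [hpv, true_imp_iff]
      induction hpv with
      | single h => exact ⟨1, fun val dec x m hm t => knows_of_adj hm h.2.1 h.1 t⟩
      | tail _ h ih =>
        obtain ⟨d, hd⟩ := ih
        exact ⟨d + 1, fun val dec x m hm t => (hd val dec x m hm t).relay hm h.2.1 h.1⟩
    · exact ⟨0, fun h => absurd h hpv⟩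
  choose d hd using h
  refine ⟨Finset.univ.sup d + 1, by omega, fun val dec x F m hm p v hpv t => ?_⟩
  refine (hd (F, p, v) hpv val dec x m hm t).mono ?_
  have : d (F, p, v) ≤ Finset.univ.sup d := Finset.le_sup (Finset.mem_univ _)
  omega

end FullInformation

/-! ### The consensus algorithm -/

/-- The local history `h` contains a report signed by each member of `S` of time `t`. -/
def HasViews (S : Finset V) (t : ℕ) (h : History V) : Prop :=
  ∀ p ∈ S, ∃ c B, Knows h (.signed p (report t c B))

/-- The nodes that claim value `0` at time `t₀` according to the reports by members of `S` of time
`t₁` that are known in the local history `h`. -/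
def zeroClaims (S : Finset V) (t₀ t₁ : ℕ) (h : History V) : Set V :=
  {q | ∃ p ∈ S, ∃ c B B', Knows h (.signed p (report t₁ c B)) ∧
    Msg.signed q (report t₀ false B') ∈ B.parts}

open Classical in
/-- The value after `k` phases of `2 * L` rounds of a node with input `b`, where phase `i` uses the
root set `S i`. Only the part of the local history up to the end of phase `k - 1` matters. -/
noncomputable def phaseValue (f L : ℕ) (S : ℕ → Finset V) : ℕ → Bool → History V → Bool
  | 0, b, _ => b
  | k + 1, b, h =>
    if HasViews (S k) (2 * L * k + L) (h.take (2 * L * (k + 1))) then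
      decide ((zeroClaims (S k) (2 * L * k) (2 * L * k + L)
        (h.take (2 * L * (k + 1)))).ncard < f + 1)
    else phaseValue f L S k b h

/-- The full-information algorithm in which the reported value is the value after the last completed
phase, and the value after `K` phases is output. -/
noncomputable def phaseAlgorithm [Fintype V] (f L : ℕ) (S : ℕ → Finset V) (K : ℕ) : Algorithm V :=
  fullInformation (fun b h => phaseValue f L S (h.length / (2 * L)) b h)
    fun b h => if h.length = 2 * L * K then some (phaseValue f L S K b h) else none

section PhaseAlgorithm

variable {f L K : ℕ} {S : ℕ → Finset V} {x : V → Bool} {m : Trace V}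

/-- The value of node `v` after `k` phases of an execution. -/
noncomputable def value (f L : ℕ) (S : ℕ → Finset V) (x : V → Bool) (m : Trace V) (k : ℕ)
    (v : V) : Bool :=
  phaseValue f L S k (x v) (history m v (2 * L * k))

theorem phaseValue_history {t : ℕ} (k : ℕ) (v : V) (ht : 2 * L * k ≤ t) :
    phaseValue f L S k (x v) (history m v t) = value f L S x m k v := by
  suffices h : ∀ s t, 2 * L * k ≤ s → 2 * L * k ≤ t →
      phaseValue f L S k (x v) (history m v s) = phaseValue f L S k (x v) (history m v t) from
    h _ _ ht le_rfl
  clear ht t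
  induction k with
  | zero => intros; rfl
  | succ k ih =>
    intro s t hs ht
    have : 2 * L * k ≤ 2 * L * (k + 1) := Nat.mul_le_mul_left _ (by omega)
    rw [phaseValue, phaseValue, take_history m v hs, take_history m v ht,
      ih s t (by omega) (by omega)]

open Classical in
theorem value_succ (k : ℕ) (v : V) : value f L S x m (k + 1) v =
    if HasViews (S k) (2 * L * k + L) (history m v (2 * L * (k + 1))) then
      decide ((zeroClaims (S k) (2 * L * k) (2 * L * k + L)
        (history m v (2 * L * (k + 1)))).ncard < f + 1)
    else value f L S x m k v := by
  rw [value, phaseValue, take_history m v le_rfl,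
    phaseValue_history k v (Nat.mul_le_mul_left _ (by omega))]

variable [Fintype V] {G : Digraph V} {F : Finset V}

theorem outputs_phaseAlgorithm_iff {v : V} {y : Bool} :
    Outputs (phaseAlgorithm f L S K) x m v y ↔ y = value f L S x m K v := by
  simp only [Outputs, phaseAlgorithm, fullInformation, length_history]
  constructor
  · rintro ⟨t, ht, -⟩
    split_ifs at ht with h
    cases ht
    rw [h, value]
  · rintro rfl
    exact ⟨2 * L * K, by simp [value], fun s hs => if_neg hs.ne⟩

/-- The content which the non-faulty node `u` signs in round `t` of the phase algorithm. -/
noncomputable abbrev phaseReport (f L : ℕ) (S : ℕ → Finset V) (x : V → Bool) (m : Trace V) :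
    V → ℕ → Msg V :=
  ownReport (fun b h => phaseValue f L S (h.length / (2 * L)) b h) x m

theorem phaseReport_eq (hL : 0 < L) (q : V) (k : ℕ) : phaseReport f L S x m q (2 * L * k) =
    report (2 * L * k) (value f L S x m k q) (bundle (history m q (2 * L * k))) := by
  simp only [phaseReport, ownReport, length_history, value]
  rw [Nat.mul_div_cancel_left _ (by omega)]

theorem eq_bundle_of_report_eq {q : V} {s t : ℕ} {c : Bool} {B : Msg V}
    (h : report t c B = phaseReport f L S x m q s) : B = bundle (history m q t) := by
  obtain ⟨rfl, -, rfl⟩ := report_inj.1 h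
  rfl

theorem eq_value_of_report_eq (hL : 0 < L) {q : V} {s k : ℕ} {c : Bool} {B : Msg V}
    (h : report (2 * L * k) c B = phaseReport f L S x m q s) : c = value f L S x m k q := by
  obtain ⟨rfl, -, -⟩ := report_inj.1 h
  rw [phaseReport_eq hL] at h
  exact (report_inj.1 h).2.1

/-- Every phase is valid: a non-faulty node ends it with a value that a non-faulty node had at the
start of the phase. -/
theorem exists_value_eq (hL : 0 < L) (hS : ∀ k, f + 1 ≤ (S k).card) (hF : F.card ≤ f)
    (hm : IsExecution G (phaseAlgorithm f L S K) x F m)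
    (hdelay : ∀ p v, Relation.TransGen (G.AdjOff F) p v → ∀ t,
      Knows (history m v (t + L)) (.signed p (phaseReport f L S x m p t)))
    {R : Finset V} (hR : f + 1 ≤ R.card) (hroot : G.IsRootSet F R) (k : ℕ) {v : V} (hv : v ∉ F) :
    ∃ u ∉ F, value f L S x m (k + 1) v = value f L S x m k u := by
  classical
  rw [value_succ]
  split_ifs with hviews
  swap
  · exact ⟨v, hv, rfl⟩
  set Z := zeroClaims (S k) (2 * L * k) (2 * L * k + L) (history m v (2 * L * (k + 1)))
  have hZ : Z.ncard = Z.toFinite.toFinset.card := Set.ncard_eq_toFinset_card _ _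
  by_cases hcard : Z.ncard < f + 1
  · -- Some `q` in the root set `R` does not claim `0` in the view of a non-faulty `p`, which must
    -- contain the claim of `q`.
    obtain ⟨q, hqR, hqZ⟩ := Finset.exists_mem_notMem_of_card_lt_card
      (show Z.toFinite.toFinset.card < R.card by omega)
    obtain ⟨p, hpS, hpF⟩ := Finset.exists_mem_notMem_of_card_lt_card
      (show F.card < (S k).card by have := hS k; omega)
    refine ⟨q, (hroot q hqR).1, ?_⟩
    rw [decide_eq_true hcard]
    by_contra hne
    have hval : value f L S x m k q = false := by simpa using Ne.symm hne
    apply hqZ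
    rw [Set.Finite.mem_toFinset]
    obtain ⟨c, B, hB⟩ := hviews p hpS
    obtain ⟨s, hs⟩ := hB.genuine hm hpF
    refine ⟨p, hpS, c, B, bundle (history m q (2 * L * k)), hB, ?_⟩
    rw [eq_bundle_of_report_eq hs, signed_mem_parts_bundle, ← hval, ← phaseReport_eq hL]
    exact hdelay q p ((hroot q hqR).2 p hpF) _
  · obtain ⟨q, hqZ, hqF⟩ := Finset.exists_mem_notMem_of_card_lt_card
      (show F.card < Z.toFinite.toFinset.card by omega)
    rw [Set.Finite.mem_toFinset] at hqZ
    obtain ⟨p, -, c, B, B', hB, hB'⟩ := hqZ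
    obtain ⟨s, hs⟩ := (hB.of_report hB').genuine hm hqF
    exact ⟨q, hqF, by rw [decide_eq_false hcard]; exact eq_value_of_report_eq hL hs⟩

/-- In a phase whose root set belongs to the actual faulty set, all non-faulty nodes evaluate the
same views. -/
theorem value_eq_of_rootSet (hm : IsExecution G (phaseAlgorithm f L S K) x F m)
    (hdelay : ∀ p v, Relation.TransGen (G.AdjOff F) p v → ∀ t,
      Knows (history m v (t + L)) (.signed p (phaseReport f L S x m p t)))
    {k : ℕ} (hroot : G.IsRootSet F (S k)) {u v : V} (hu : u ∉ F) (hv : v ∉ F) :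
    value f L S x m (k + 1) u = value f L S x m (k + 1) v := by
  classical
  have hknow : ∀ w ∉ F, ∀ p ∈ S k, Knows (history m w (2 * L * (k + 1)))
      (.signed p (phaseReport f L S x m p (2 * L * k + L))) := by
    intro w hw p hp
    have := hdelay p w ((hroot p hp).2 w hw) (2 * L * k + L)
    rwa [show 2 * L * k + L + L = 2 * L * (k + 1) by ring] at this
  have hclaims : ∀ w ∉ F, value f L S x m (k + 1) w =
      decide ({q | ∃ p ∈ S k, ∃ B', Msg.signed q (report (2 * L * k) false B') ∈
        (bundle (history m p (2 * L * k + L))).parts}.ncard < f + 1) := by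
    intro w hw
    have hviews : HasViews (S k) (2 * L * k + L) (history m w (2 * L * (k + 1))) :=
      fun p hp => ⟨_, _, hknow w hw p hp⟩
    rw [value_succ, if_pos hviews]
    congr 3
    ext q
    constructor
    · rintro ⟨p, hp, c, B, B', hB, hB'⟩
      obtain ⟨s, hs⟩ := hB.genuine hm (hroot p hp).1
      exact ⟨p, hp, B', eq_bundle_of_report_eq hs ▸ hB'⟩
    · rintro ⟨p, hp, B', hB'⟩
      exact ⟨p, hp, _, _, B', hknow w hw p hp, hB'⟩
  rw [hclaims u hu, hclaims v hv]

end PhaseAlgorithm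

theorem exists_solvesConsensus [Fintype V] {G : Digraph V} {f : ℕ} (hf : 0 < f)
    (hG : G.ConditionS f) : ∃ A : Algorithm V, SolvesConsensus G f A := by
  classical
  obtain ⟨L, hL, hdelay⟩ := exists_delay G
  -- Sets with more than `f` nodes get the root set of `∅`, so that their phases are valid, too.
  have hR : ∀ F : Finset V, ∃ R : Finset V, f + 1 ≤ R.card ∧ (F.card ≤ f → G.IsRootSet F R) := by
    intro F
    by_cases hF : F.card ≤ f
    · obtain ⟨R, hR, hroot⟩ := hG.exists_isRootSet hf F hF
      exact ⟨R, hR, fun _ => hroot⟩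
    · obtain ⟨R, hR, -⟩ := hG.exists_isRootSet hf ∅ (by simp)
      exact ⟨R, hR, fun h => absurd h hF⟩
  choose R hRcard hRroot using hR
  let e := Fintype.equivFin (Finset V)
  have he : Function.Injective fun F => (e F : ℕ) := Fin.val_injective.comp e.injective
  let S : ℕ → Finset V := fun k => R (Function.invFun (fun F => (e F : ℕ)) k)
  have hScard : ∀ k, f + 1 ≤ (S k).card := fun k => hRcard _
  have hSroot : ∀ F : Finset V, F.card ≤ f → G.IsRootSet F (S (e F)) := by
    intro F hF
    have h : S (e F) = R F := congrArg R (Function.leftInverse_invFun he F)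
    exact h ▸ hRroot F hF
  let K := Fintype.card (Finset V)
  have hvalid : ∀ (F : Finset V), F.card ≤ f → ∀ (x : V → Bool) (m : Trace V),
      IsExecution G (phaseAlgorithm f L S K) x F m → ∀ k, ∀ v ∉ F,
      ∃ u ∉ F, value f L S x m (k + 1) v = value f L S x m k u := by
    intro F hF x m hm k v hv
    exact exists_value_eq hL hScard hF hm (hdelay _ _ x F m hm) (hRcard F) (hRroot F hF) k hv
  refine ⟨phaseAlgorithm f L S K, ?_, ?_, ?_⟩
  · intro F hF x m hm v hv
    exact ⟨_, outputs_phaseAlgorithm_iff.2 rfl⟩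
  · intro F hF x m hm v hv y hy
    rw [outputs_phaseAlgorithm_iff.1 hy]
    have hk : ∀ k, ∀ v ∉ F, ∃ u ∉ F, value f L S x m k v = x u := by
      intro k
      induction k with
      | zero => exact fun v hv => ⟨v, hv, rfl⟩
      | succ k ih =>
        intro v hv
        obtain ⟨u, hu, h⟩ := hvalid F hF x m hm k v hv
        rw [h]
        exact ih u hu
    exact hk K v hv
  · intro F hF x m hm u hu v hv y z hy hz
    rw [outputs_phaseAlgorithm_iff.1 hy, outputs_phaseAlgorithm_iff.1 hz]
    have hk : ∀ k, (e F : ℕ) + 1 ≤ k → ∀ u ∉ F, ∀ v ∉ F,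
        value f L S x m k u = value f L S x m k v := by
      intro k hk
      induction k, hk using Nat.le_induction with
      | base =>
        intro u hu v hv
        exact value_eq_of_rootSet hm (hdelay _ _ x F m hm) (hSroot F hF) hu hv
      | succ k _ ih =>
        intro u hu v hv
        obtain ⟨u', hu', h1⟩ := hvalid F hF x m hm k u hu
        obtain ⟨v', hv', h2⟩ := hvalid F hF x m hm k v hv
        rw [h1, h2, ih u' hu' v' hv']
    exact hk K (e F).isLt u hu v hv

end AuthSync

theorem mainTheorem1 {V : Type*} [Fintype V] (G : Digraph V) (f : ℕ)
    (hf : 0 < f) (hn : f < Fintype.card V) :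
    (∃ A : AuthSync.Algorithm V, AuthSync.SolvesConsensus G f A) ↔ G.ConditionS f :=
  ⟨fun ⟨_, hA⟩ => hA.conditionS hn, AuthSync.exists_solvesConsensus hf⟩
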